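/- Let $G$ be a compact topological group acting continuously and transitively on a topological space $M$, and let $\mu$ be the normalized $G$-invariant measure on $M$, i.e. the regular Borel probability measure with $\mu(gE)=\mu(E)$ for all $g\in G$ and all Borel sets $E\subseteq M$. For $g\in G$ write $(\tau_g f)(x)=f(g^{-1}x)$. Let $1\le p,q\le 2$ and let $r$ be defined by $\frac1r=\frac1p+\frac1q$ (so $\frac12\le r\le 1$). For $m=1,2,\dots$ let $T_m:L^p(M,\mu)\times L^q(M,\mu)\to L^r(M,\mu)$ be bilinear operators (over the real or the complex scalars) such that: (a) each $T_m$ is bounded: there is a constant $C_m$, which may depend on $m$, with $\|T_m(f,h)\|_{L^r}\le C_m\|f\|_{L^p}\|h\|_{L^q}$ for all $f\in L^p(M,\mu)$, $h\in L^q(M,\mu)$; (b) each $T_m$ commutes with simultaneous translations: $T_m(\tau_g f,\tau_g h)=\tau_g T_m(f,h)$ almost everywhere, for all $g\in G$, $f\in L^p(M,\mu)$, $h\in L^q(M,\mu)$; (c) for all $f\in L^p(M,\mu)$ and $h\in L^q(M,\mu)$, the (finite) limit $\lim_{m\to\infty}T_m(f,h)(x)$ exists for $\mu$-almost every $x\in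 M$. Let $T^*(f,h)(x)=\sup_{m\ge1}|T_m(f,h)(x)|$. Then there is a constant $C>0$ such that for all $f\in L^p(M,\mu)$, $h\in L^q(M,\mu)$ and all $\alpha>0$, $$\mu\big(\{x\in M: T^*(f,h)(x)>\alpha\}\big)\le \frac{C}{\alpha^r}\,\|f\|_{L^p}^r\,\|h\|_{L^q}^r .$$ -/

import Mathlib

open MeasureTheory Filter Topology
open scoped ENNReal

noncomputable section

/-- The translation operator `(τ_g f)(x) = f (g⁻¹ x)` on `L^p(M, μ)`, where `μ` is `G`-invariant. -/
def lpTranslate {𝕜 G M : Type*} [RCLike 𝕜] [Group G] [MulAction G M] [MeasurableSpace M]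
    [MeasurableConstSMul G M] {μ : Measure M} [SMulInvariantMeasure G M μ] {p : ℝ≥0∞}
    (g : G) (f : Lp 𝕜 p μ) : Lp 𝕜 p μ :=
  Lp.compMeasurePreserving (fun x : M => g⁻¹ • x) (measurePreserving_smul g⁻¹ μ) f

/-- A bilinear operator `L^p × L^q → L^r` is bounded if
`‖T(f, h)‖_r ≤ C ‖f‖_p ‖h‖_q` for some constant `C`. Here `‖·‖_r` is `(∫ |·|^r)^{1/r}`, which is
only a quasinorm for `r < 1`. -/
def IsBoundedBilinear {𝕜 M : Type*} [RCLike 𝕜] [MeasurableSpace M] {μ : Measure M}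
    {p q r : ℝ≥0∞} (T : Lp 𝕜 p μ →ₗ[𝕜] Lp 𝕜 q μ →ₗ[𝕜] Lp 𝕜 r μ) : Prop :=
  ∃ C : ℝ, ∀ (f : Lp 𝕜 p μ) (h : Lp 𝕜 q μ), ‖T f h‖ ≤ C * ‖f‖ * ‖h‖

/-- `T` commutes with simultaneous translations: `T(τ_g f, τ_g h) = τ_g T(f, h)` for all `g`. -/
def CommutesWithTranslations (G : Type*) {𝕜 M : Type*} [RCLike 𝕜] [Group G] [MulAction G M]
    [MeasurableSpace M] [MeasurableConstSMul G M] {μ : Measure M} [SMulInvariantMeasure G M μ]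
    {p q r : ℝ≥0∞} (T : Lp 𝕜 p μ →ₗ[𝕜] Lp 𝕜 q μ →ₗ[𝕜] Lp 𝕜 r μ) : Prop :=
  ∀ (g : G) (f : Lp 𝕜 p μ) (h : Lp 𝕜 q μ),
    T (lpTranslate g f) (lpTranslate g h) = lpTranslate g (T f h)

/-- The maximal operator `T*(f, h)(x) = sup_m |T_m(f, h)(x)|`, with values in `[0, ∞]`. -/
def maximalOperator {𝕜 M : Type*} [RCLike 𝕜] [MeasurableSpace M] {μ : Measure M}
    {p q r : ℝ≥0∞} (T : ℕ → Lp 𝕜 p μ →ₗ[𝕜] Lp 𝕜 q μ →ₗ[𝕜] Lp 𝕜 r μ)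
    (f : Lp 𝕜 p μ) (h : Lp 𝕜 q μ) (x : M) : ℝ≥0∞ :=
  ⨆ m : ℕ, ‖T m f h x‖ₑ

end

/-! ### Compact transitive actions: topology of the space and covering by translates. -/

section CompactTransitive

variable {G M : Type*} [Group G] [TopologicalSpace G] [IsTopologicalGroup G] [CompactSpace G]
  [TopologicalSpace M] [MulAction G M] [ContinuousSMul G M]

/-! Almost everywhere convergence enters only through `T* < ∞` a.e. Baire category makes this
uniform: there is `L` such that `{T*(f, h) > L}` has measure at most 1/32 for all `f`, `h` in the
unit balls (`exists_measure_lt_maximalOperator_le`).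

Let `E = {T*(f, h) > α}` have positive measure. Averaging over Haar measure of `G` shows that about
`2 / μ E` translates of `E`, say `N`, cover half of `M` (`exists_half_le_measureReal_iUnion_smul`).
Put `F = ∑ ε_k τ_{g_k} f` and `H = ∑ δ_k τ_{g_k} h` with independent signs. Flipping the k-th signs
recovers `4 T_m(τ_{g_k} f, τ_{g_k} h)`, up to sign, from four values `T_m(F, H)`; hence at almost
every point of the cover `T*(F, H) > α` for at least a quarter of the sign choices
(`card_mul_card_mul_measure_iUnion_le`).

Since `p, q ≤ 2`, the spaces have type `p` and `q`: the mean of `‖F‖^p` is at most `N ‖f‖^p`, and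
similarly for `H`. So some signs give both small norms and `μ {T*(F, H) > α} ≥ 1/16 > 1/32`. The
uniform bound then forces `α ≤ L (32 N)^{1/p + 1/q} ‖f‖ ‖h‖`, and `1/p + 1/q = 1/r` with `N μ(E) ≤
3` gives the weak type estimate. -/

theorem smul_specializes_of_specializes_smul {k : G} {z : M} (h : z ⤳ (k • z)) :
    (k • z) ⤳ z := by
  have hpow : ∀ n : ℕ, (k • z) ⤳ (k ^ (n + 1) • z) := by
    intro n
    induction n with
    | zero => simp [specializes_rfl]
    | succ n ih =>
      have := h.map (continuous_const_smul (k ^ (n + 1)))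
      simp only [smul_smul, ← pow_succ] at this
      exact ih.trans this
  -- In a compact group the powers of `k` cluster at 1, so the orbit returns to every neighbourhood
  -- of `z`.
  have hcl : MapClusterPt z atTop (fun n : ℕ => k ^ n • z) := by
    have hc : ContinuousAt (fun g : G => g • z) 1 := by fun_prop
    simpa [Function.comp_def] using (mapClusterPt_one_atTop_pow k).continuousAt_comp hc
  refine specializes_iff_forall_open.2 fun t ht hz => ?_
  obtain ⟨n, hnt, hn⟩ := ((mapClusterPt_iff_frequently.1 hcl t (ht.mem_nhds hz)).and_eventually
    (eventually_ge_atTop 1)).exists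
  obtain ⟨m, rfl⟩ : ∃ m, n = m + 1 := ⟨n - 1, by omega⟩
  exact (hpow m).mem_open ht hnt

variable (G M) in
-- No separation of `M` is assumed; this substitute is what the approximation of indicators by
-- continuous functions needs below.
theorem r1Space_of_isPretransitive [MulAction.IsPretransitive G M] : R1Space M := by
  have hsymm : ∀ z x : M, z ⤳ x → x ⤳ z := by
    intro z x h
    obtain ⟨k, rfl⟩ := MulAction.exists_smul_eq G z x
    exact smul_specializes_of_specializes_smul h
  refine ⟨fun x y => ?_⟩
  by_contra! hxy
  obtain ⟨hxy, hd⟩ := hxy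
  have hne : (𝓝 x ⊓ 𝓝 y).NeBot := by
    rwa [neBot_iff, ne_eq, ← disjoint_iff]
  apply hxy
  have hsurj : Function.Surjective (fun g : G => g • x) := MulAction.exists_smul_eq G x
  have : (comap (fun g : G => g • x) (𝓝 x ⊓ 𝓝 y)).NeBot := hne.comap_of_surj hsurj
  obtain ⟨g₀, hg₀⟩ := exists_clusterPt_of_compactSpace (comap (fun g : G => g • x) (𝓝 x ⊓ 𝓝 y))
  set 𝒱 := 𝓝 g₀ ⊓ comap (fun g : G => g • x) (𝓝 x ⊓ 𝓝 y) with h𝒱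
  have : 𝒱.NeBot := hg₀
  have hV₀ : Tendsto (fun g : G => g) 𝒱 (𝓝 g₀) := tendsto_id'.2 inf_le_left
  have hV : Tendsto (fun g : G => g • x) 𝒱 (𝓝 x ⊓ 𝓝 y) := tendsto_comap.mono_left inf_le_right
  have hone : Tendsto (fun g : G => g₀ * g⁻¹) 𝒱 (𝓝 1) := by
    simpa using (tendsto_const_nhds (x := g₀)).mul hV₀.inv
  -- The constant `g₀ • x = (g₀ * g⁻¹) • (g • x)` tends to `1 • w`.
  have key : ∀ w : M, Tendsto (fun g : G => g • x) 𝒱 (𝓝 w) → (g₀ • x) ⤳ w := by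
    intro w hw
    have := hone.smul hw
    simp only [smul_smul, inv_mul_cancel_right, one_smul] at this
    rw [specializes_iff_pure]
    simpa [Tendsto, Filter.map_const] using this
  exact (hsymm _ _ (key x (hV.mono_right inf_le_left))).trans (key y (hV.mono_right inf_le_right))

variable [MulAction.IsPretransitive G M] [MeasurableSpace M] [BorelSpace M]
  (μ : Measure M) [μ.Regular] [IsProbabilityMeasure μ] [SMulInvariantMeasure G M μ]

variable (G) in
-- The Haar average of `μ (gE ∩ B)` is `μ E * μ B`, so some `g` does at least as well. Fubini is
-- applied to a continuous approximation of the indicator of `E`, which avoids joint measurability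
-- on `G × M` and costs `η`.
theorem exists_measureReal_smul_inter_ge {E : Set M} (hE : MeasurableSet E) (B : Set M)
    {η : ℝ} (hη : 0 < η) :
    ∃ g : G, μ.real E * μ.real B - η ≤ μ.real ((fun x : M => g⁻¹ • x) ⁻¹' E ∩ B) := by
  classical
  have := r1Space_of_isPretransitive G M
  obtain ⟨x₀⟩ : Nonempty M := nonempty_of_isProbabilityMeasure μ
  have hcM : CompactSpace M := by
    refine ⟨?_⟩
    rw [← Set.range_eq_univ.2 (MulAction.exists_smul_eq G x₀)]
    exact isCompact_range (by fun_prop)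
  borelize G
  let ν : Measure G := Measure.haarMeasure ⊤
  have hν : IsProbabilityMeasure ν := ⟨by
    simpa using Measure.haarMeasure_self (K₀ := (⊤ : TopologicalSpace.PositiveCompacts G))⟩
  have hint : Integrable (E.indicator (fun _ => (1 : ℝ))) μ :=
    (integrable_const 1).indicator hE
  obtain ⟨f, -, hfE, hfc, hfi⟩ :=
    hint.exists_hasCompactSupport_integral_sub_le (ε := η / 2) (by positivity)
  have hcf : Continuous (fun z : G × M => f (z.1⁻¹ • z.2)) := by fun_prop
  have hconst : ∀ x : M, ∫ g, f (g⁻¹ • x) ∂ν = ∫ g, f (g⁻¹ • x₀) ∂ν := by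
    intro x
    obtain ⟨k, rfl⟩ := MulAction.exists_smul_eq G x₀ x
    rw [← integral_mul_left_eq_self _ k]
    simp [smul_smul, mul_assoc]
  have hswap : ∀ S : Set M, ∫ g, ∫ x in S, f (g⁻¹ • x) ∂μ ∂ν
      = μ.real S * ∫ g, f (g⁻¹ • x₀) ∂ν := by
    intro S
    rw [integral_integral_swap_of_hasCompactSupport (f := fun (g : G) (x : M) => f (g⁻¹ • x)) hcf
      (HasCompactSupport.of_compactSpace _)]
    simp [hconst]
  have hinv : ∀ (φ : M → ℝ) (g : G), ∫ x, φ (g⁻¹ • x) ∂μ = ∫ x, φ x ∂μ :=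
    fun φ g => integral_smul_eq_self φ (g := g⁻¹)
  have hmean : ∫ g, f (g⁻¹ • x₀) ∂ν = ∫ x, f x ∂μ := by
    have := hswap Set.univ
    simpa [hinv] using this.symm
  have hcont : Continuous (fun g : G => ∫ x in B, f (g⁻¹ • x) ∂μ) := by
    rw [← continuousOn_univ]
    exact continuousOn_integral_of_compact_support (f := fun (g : G) (x : M) => f (g⁻¹ • x))
      isCompact_univ hcf.continuousOn (by simp)
  obtain ⟨g, hg⟩ := exists_integral_le (μ := ν) (f := fun g : G => ∫ x in B, f (g⁻¹ • x) ∂μ)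
    (hcont.integrable_of_hasCompactSupport (HasCompactSupport.of_compactSpace _))
  rw [hswap, hmean] at hg
  refine ⟨g, ?_⟩
  have hEf : μ.real E - η / 2 ≤ ∫ x, f x ∂μ := by
    have h1 : ∫ x, (E.indicator (fun _ => (1 : ℝ)) x - f x) ∂μ ≤ η / 2 :=
      ((Real.le_norm_self _).trans (norm_integral_le_integral_norm _)).trans hfE
    rw [integral_sub hint hfi, integral_indicator_const _ hE] at h1
    simp at h1
    linarith
  have hfgi : Integrable (fun x => f (g⁻¹ • x)) μ :=
    (measurePreserving_smul g⁻¹ μ).integrable_comp_of_integrable hfi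
  have hEgi : Integrable (fun x => E.indicator (fun _ => (1 : ℝ)) (g⁻¹ • x)) μ :=
    (measurePreserving_smul g⁻¹ μ).integrable_comp_of_integrable hint
  have h2 : ∫ x in B, f (g⁻¹ • x) ∂μ - μ.real ((fun x : M => g⁻¹ • x) ⁻¹' E ∩ B) ≤ η / 2 := by
    have h3 : μ.real ((fun x : M => g⁻¹ • x) ⁻¹' E ∩ B)
        = ∫ x in B, E.indicator (fun _ => (1 : ℝ)) (g⁻¹ • x) ∂μ := by
      have : (fun x : M => E.indicator (fun _ => (1 : ℝ)) (g⁻¹ • x))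
          = ((fun x : M => g⁻¹ • x) ⁻¹' E).indicator (fun _ => (1 : ℝ)) := by
        ext x; simp [Set.indicator]
      have hm : MeasurableSet ((fun x : M => g⁻¹ • x) ⁻¹' E) := measurable_const_smul g⁻¹ hE
      rw [this, integral_indicator_const _ hm, measureReal_restrict_apply hm]
      simp
    rw [h3, ← integral_sub hfgi.integrableOn hEgi.integrableOn]
    calc _ ≤ ∫ x in B, ‖E.indicator (fun _ => (1 : ℝ)) (g⁻¹ • x) - f (g⁻¹ • x)‖ ∂μ := by
          refine (Real.le_norm_self _).trans ((norm_integral_le_integral_norm _).trans_eq ?_)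
          simp_rw [norm_sub_rev]
      _ ≤ ∫ x, ‖E.indicator (fun _ => (1 : ℝ)) (g⁻¹ • x) - f (g⁻¹ • x)‖ ∂μ :=
          setIntegral_le_integral (hEgi.sub hfgi).norm (ae_of_all _ fun _ => norm_nonneg _)
      _ ≤ η / 2 := (hinv (fun x => ‖E.indicator (fun _ => (1 : ℝ)) x - f x‖) g).trans_le hfE
  have hB1 : μ.real B ≤ 1 := measureReal_le_one
  have hB0 : 0 ≤ μ.real B := measureReal_nonneg
  nlinarith

variable (G) in
-- Greedy choice: each new translate removes at least the fraction `μ E / 2` of what is still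
-- uncovered.
theorem exists_measureReal_compl_iUnion_smul_le {E : Set M} (hE : MeasurableSet E)
    (h0 : 0 < μ.real E) (N : ℕ) :
    ∃ g : Fin N → G,
      μ.real (⋃ k, (fun x : M => (g k)⁻¹ • x) ⁻¹' E)ᶜ ≤ (1 - μ.real E / 2) ^ N := by
  have hm : ∀ g : G, MeasurableSet ((fun x : M => g⁻¹ • x) ⁻¹' E) :=
    fun g => measurable_const_smul g⁻¹ hE
  induction N with
  | zero => exact ⟨Fin.elim0, by simp⟩
  | succ N ih =>
    obtain ⟨g, hg⟩ := ih
    set B := (⋃ k, (fun x : M => (g k)⁻¹ • x) ⁻¹' E)ᶜ with hBdef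
    have hBm : MeasurableSet B := (MeasurableSet.iUnion fun k => hm _).compl
    have h1 : 0 ≤ 1 - μ.real E / 2 := by
      have : μ.real E ≤ 1 := measureReal_le_one
      linarith
    rcases (measureReal_nonneg (μ := μ) (s := B)).eq_or_lt with hB0 | hB0
    · refine ⟨Fin.cons 1 g, ?_⟩
      refine (measureReal_mono (Set.compl_subset_compl.2 ?_)).trans (hB0.symm.le.trans (by positivity))
      exact Set.iUnion_subset fun k => Set.subset_iUnion_of_subset k.succ (by simp)
    · obtain ⟨γ, hγ⟩ := exists_measureReal_smul_inter_ge G μ hE B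
        (η := μ.real E * μ.real B / 2) (by positivity)
      refine ⟨Fin.cons γ g, ?_⟩
      have hset : (⋃ k, (fun x : M => ((Fin.cons γ g : Fin (N + 1) → G) k)⁻¹ • x) ⁻¹' E)ᶜ
          = B \ ((fun x : M => γ⁻¹ • x) ⁻¹' E) := by
        ext x
        simp [hBdef, Fin.forall_fin_succ, and_comm]
      have h2 := measureReal_inter_add_sdiff (μ := μ) (s := B) (hm γ)
      rw [hset, pow_succ]
      rw [Set.inter_comm] at hγ
      nlinarith

variable (G) in
/-- A set of positive measure has boundedly many translates covering half of the space. -/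
theorem exists_half_le_measureReal_iUnion_smul {E : Set M} (hE : MeasurableSet E)
    (h0 : 0 < μ.real E) :
    ∃ (N : ℕ) (g : Fin N → G), 0 < N ∧ N * μ.real E ≤ 3 ∧
      1 / 2 ≤ μ.real (⋃ k, (fun x : M => (g k)⁻¹ • x) ⁻¹' E) := by
  have h1 : μ.real E ≤ 1 := measureReal_le_one
  have hN := Nat.le_ceil (2 / μ.real E)
  have hN' := Nat.ceil_lt_add_one (a := 2 / μ.real E) (by positivity)
  have hN0 : 0 < ⌈2 / μ.real E⌉₊ := Nat.ceil_pos.2 (by positivity)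
  generalize ⌈2 / μ.real E⌉₊ = N at hN hN' hN0
  obtain ⟨g, hg⟩ := exists_measureReal_compl_iUnion_smul_le G μ hE h0 N
  refine ⟨N, g, hN0, ?_, ?_⟩
  · have : (N : ℝ) * μ.real E ≤ (2 / μ.real E + 1) * μ.real E := by gcongr
    have h3 : (2 / μ.real E + 1) * μ.real E = 2 + μ.real E := by field_simp
    linarith
  · have h2 : (1 - μ.real E / 2) ^ N ≤ Real.exp (-1) := by
      calc (1 - μ.real E / 2) ^ N ≤ Real.exp (-(μ.real E / 2)) ^ N := by
            gcongr
            · linarith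
            · exact Real.one_sub_le_exp_neg _
        _ = Real.exp (-(N * (μ.real E / 2))) := by rw [← Real.exp_nat_mul]; ring_nf
        _ ≤ Real.exp (-1) := by
            rw [div_le_iff₀ h0] at hN
            gcongr
            linarith
    have h3 := Real.exp_neg_one_lt_half
    have hm : MeasurableSet (⋃ k, (fun x : M => (g k)⁻¹ • x) ⁻¹' E) :=
      MeasurableSet.iUnion fun k => measurable_const_smul (g k)⁻¹ hE
    rw [probReal_compl_eq_one_sub hm] at hg
    linarith

end CompactTransitive

/-! ### The maximal operator and the Baire category argument. -/

section MaximalOperator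

variable {𝕜 M : Type*} [RCLike 𝕜] [MeasurableSpace M] {μ : Measure M} {p q r : ℝ≥0∞}
  (T : ℕ → Lp 𝕜 p μ →ₗ[𝕜] Lp 𝕜 q μ →ₗ[𝕜] Lp 𝕜 r μ)

theorem measurable_maximalOperator (f : Lp 𝕜 p μ) (h : Lp 𝕜 q μ) :
    Measurable (maximalOperator T f h) :=
  Measurable.iSup fun m => (Lp.stronglyMeasurable (T m f h)).enorm

theorem maximalOperator_sub_sub_le (f₁ f₂ : Lp 𝕜 p μ) (h₁ h₂ : Lp 𝕜 q μ) :
    ∀ᵐ x ∂μ, maximalOperator T (f₁ - f₂) (h₁ - h₂) x ≤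
      maximalOperator T f₁ h₁ x + maximalOperator T f₁ h₂ x +
        (maximalOperator T f₂ h₁ x + maximalOperator T f₂ h₂ x) := by
  have key : ∀ m, ∀ᵐ x ∂μ, T m (f₁ - f₂) (h₁ - h₂) x =
      T m f₁ h₁ x - T m f₁ h₂ x - (T m f₂ h₁ x - T m f₂ h₂ x) := by
    intro m
    have : T m (f₁ - f₂) (h₁ - h₂) = (T m f₁ h₁ - T m f₁ h₂) - (T m f₂ h₁ - T m f₂ h₂) := by
      simp only [map_sub, LinearMap.sub_apply]; abel
    rw [this]
    filter_upwards [Lp.coeFn_sub (T m f₁ h₁ - T m f₁ h₂) (T m f₂ h₁ - T m f₂ h₂),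
      Lp.coeFn_sub (T m f₁ h₁) (T m f₁ h₂), Lp.coeFn_sub (T m f₂ h₁) (T m f₂ h₂)] with x e₁ e₂ e₃
    rw [e₁, Pi.sub_apply, e₂, e₃, Pi.sub_apply, Pi.sub_apply]
  filter_upwards [ae_all_iff.2 key] with x hx
  refine iSup_le fun m => ?_
  rw [hx m]
  refine enorm_sub_le.trans (add_le_add (enorm_sub_le.trans (add_le_add ?_ ?_))
    (enorm_sub_le.trans (add_le_add ?_ ?_)))
  · exact le_iSup (fun m => ‖T m f₁ h₁ x‖ₑ) m
  · exact le_iSup (fun m => ‖T m f₁ h₂ x‖ₑ) m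
  · exact le_iSup (fun m => ‖T m f₂ h₁ x‖ₑ) m
  · exact le_iSup (fun m => ‖T m f₂ h₂ x‖ₑ) m

theorem maximalOperator_smul_smul (c d : 𝕜) (f : Lp 𝕜 p μ) (h : Lp 𝕜 q μ) :
    ∀ᵐ x ∂μ, maximalOperator T (c • f) (d • h) x = ‖c‖ₑ * ‖d‖ₑ * maximalOperator T f h x := by
  have key : ∀ m, ∀ᵐ x ∂μ, T m (c • f) (d • h) x = c * d * T m f h x := by
    intro m
    have : T m (c • f) (d • h) = (c * d) • T m f h := by
      simp [smul_smul, mul_comm]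
    rw [this]
    filter_upwards [Lp.coeFn_smul (c * d) (T m f h)] with x e
    simpa using e
  filter_upwards [ae_all_iff.2 key] with x hx
  simp only [maximalOperator, ENNReal.mul_iSup, hx, enorm_mul]

theorem maximalOperator_lt_top_of_convergent (f : Lp 𝕜 p μ) (h : Lp 𝕜 q μ)
    (hconv : ∀ᵐ x ∂μ, ∃ l : 𝕜, Tendsto (fun m => T m f h x) atTop (𝓝 l)) :
    ∀ᵐ x ∂μ, maximalOperator T f h x < ⊤ := by
  filter_upwards [hconv] with x ⟨l, hl⟩
  obtain ⟨B, hB⟩ := hl.norm.bddAbove_range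
  refine lt_of_le_of_lt (iSup_le fun m => ?_) (ENNReal.ofReal_lt_top (r := B))
  rw [← ofReal_norm]
  exact ENNReal.ofReal_le_ofReal (hB ⟨m, rfl⟩)

theorem ae_four_lt_maximalOperator (f₁ f₂ : Lp 𝕜 p μ) (h₁ h₂ : Lp 𝕜 q μ) (a : ℝ≥0∞) :
    ∀ᵐ x ∂μ, 4 * a < maximalOperator T (f₁ - f₂) (h₁ - h₂) x →
      a < maximalOperator T f₁ h₁ x ∨ a < maximalOperator T f₁ h₂ x ∨
        a < maximalOperator T f₂ h₁ x ∨ a < maximalOperator T f₂ h₂ x := by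
  filter_upwards [maximalOperator_sub_sub_le T f₁ f₂ h₁ h₂] with x hx hlt
  by_contra! hcon
  obtain ⟨c₁, c₂, c₃, c₄⟩ := hcon
  refine absurd hlt (not_lt.2 (hx.trans ((add_le_add (add_le_add c₁ c₂)
    (add_le_add c₃ c₄)).trans_eq ?_)))
  ring

variable [Fact (1 ≤ p)] [Fact (1 ≤ q)]

/-- Continuity into measure suffices for the Baire argument and tolerates `r < 1`, where the
triangle inequality only holds with the factor `LpAddConst r`. -/
theorem IsBoundedBilinear.tendstoInMeasure {T : Lp 𝕜 p μ →ₗ[𝕜] Lp 𝕜 q μ →ₗ[𝕜] Lp 𝕜 r μ}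
    (hT : IsBoundedBilinear T) (hr0 : r ≠ 0) {ι : Type*} {l : Filter ι}
    {z : ι → Lp 𝕜 p μ × Lp 𝕜 q μ} {w : Lp 𝕜 p μ × Lp 𝕜 q μ} (hz : Tendsto z l (𝓝 w)) :
    TendstoInMeasure μ (fun i => T (z i).1 (z i).2) l (T w.1 w.2) := by
  obtain ⟨C, hC⟩ := hT
  have hle : ∀ f h, eLpNorm (T f h) r μ ≤ ENNReal.ofReal (C * ‖f‖ * ‖h‖) := by
    intro f h
    rw [← ENNReal.ofReal_toReal (Lp.eLpNorm_ne_top (T f h)), ← Lp.norm_def]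
    exact ENNReal.ofReal_le_ofReal (hC f h)
  refine tendstoInMeasure_of_tendsto_eLpNorm hr0 (fun i => Lp.aestronglyMeasurable _)
    (Lp.aestronglyMeasurable _) ?_
  have h1 : Tendsto (fun i => (z i).1) l (𝓝 w.1) := (continuous_fst.tendsto w).comp hz
  have h2 : Tendsto (fun i => (z i).2) l (𝓝 w.2) := (continuous_snd.tendsto w).comp hz
  have hlim : Tendsto (fun i => ENNReal.LpAddConst r *
      (ENNReal.ofReal (C * ‖(z i).1 - w.1‖ * ‖(z i).2‖) +
        ENNReal.ofReal (C * ‖w.1‖ * ‖(z i).2 - w.2‖))) l (𝓝 0) := by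
    have a1 : Tendsto (fun i => C * ‖(z i).1 - w.1‖ * ‖(z i).2‖) l (𝓝 0) := by
      simpa using (((h1.sub_const w.1).norm).const_mul C).mul h2.norm
    have a2 : Tendsto (fun i => C * ‖w.1‖ * ‖(z i).2 - w.2‖) l (𝓝 0) := by
      simpa using ((h2.sub_const w.2).norm).const_mul (C * ‖w.1‖)
    have := ENNReal.Tendsto.const_mul (a := ENNReal.LpAddConst r)
      ((ENNReal.tendsto_ofReal a1).add (ENNReal.tendsto_ofReal a2))
      (Or.inr (ENNReal.LpAddConst_lt_top r).ne)
    simpa using this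
  refine tendsto_of_tendsto_of_tendsto_of_le_of_le tendsto_const_nhds hlim
    (fun i => zero_le) fun i => ?_
  have hsplit : (T (z i).1 (z i).2 : M → 𝕜) - (T w.1 w.2 : M → 𝕜) =ᵐ[μ]
      (T ((z i).1 - w.1) (z i).2 : M → 𝕜) + (T w.1 ((z i).2 - w.2) : M → 𝕜) := by
    have : T (z i).1 (z i).2 - T w.1 w.2 = T ((z i).1 - w.1) (z i).2 + T w.1 ((z i).2 - w.2) := by
      simp
    exact (Lp.coeFn_sub _ _).symm.trans (by rw [this]; exact Lp.coeFn_add _ _)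
  rw [eLpNorm_congr_ae hsplit]
  refine (eLpNorm_add_le' (Lp.aestronglyMeasurable _) (Lp.aestronglyMeasurable _) r).trans ?_
  gcongr
  · exact hle _ _
  · exact hle _ _

theorem isClosed_setOf_measure_lt_maximalOperator_le (hbdd : ∀ m, IsBoundedBilinear (T m))
    (hr0 : r ≠ 0) (a ε : ℝ≥0∞) :
    IsClosed {z : Lp 𝕜 p μ × Lp 𝕜 q μ | μ {x | a < maximalOperator T z.1 z.2 x} ≤ ε} := by
  refine IsSeqClosed.isClosed fun z w hz hzw => ?_
  -- Finitely many operators and a margin `1 / j`, which absorbs the error of convergence in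
  -- measure; the `U j` increase and cover the superlevel set.
  let U : ℕ → Set M := fun j => ⋃ m ∈ Finset.range j, {x | a + (j : ℝ≥0∞)⁻¹ < ‖T m w.1 w.2 x‖ₑ}
  have hU : {x | a < maximalOperator T w.1 w.2 x} ⊆ ⋃ j, U j := by
    intro x hx
    obtain ⟨m, hm⟩ := lt_iSup_iff.1 (show a < ⨆ m, ‖T m w.1 w.2 x‖ₑ from hx)
    have hlim : Tendsto (fun j : ℕ => a + (j : ℝ≥0∞)⁻¹) atTop (𝓝 a) := by
      simpa using (tendsto_const_nhds (x := a)).add ENNReal.tendsto_inv_nat_nhds_zero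
    obtain ⟨j, hj, hjm⟩ := ((hlim.eventually_lt_const hm).and (eventually_gt_atTop m)).exists
    exact Set.mem_iUnion.2 ⟨j, Set.mem_biUnion (Finset.mem_coe.2 (Finset.mem_range.2 hjm)) hj⟩
  have hmono : Monotone U := by
    intro i j hij x hx
    simp only [U, Set.mem_iUnion, Finset.mem_range, Set.mem_ofPred_eq] at hx ⊢
    obtain ⟨m, hm, hx⟩ := hx
    refine ⟨m, hm.trans_le hij, lt_of_le_of_lt ?_ hx⟩
    gcongr
  refine (measure_mono hU).trans ?_
  rw [hmono.measure_iUnion]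
  refine iSup_le fun j => ?_
  rcases Nat.eq_zero_or_pos j with rfl | hj
  · simp [U]
  have hlim : Tendsto (fun i => ε + ∑ m ∈ Finset.range j,
      μ {x | (j : ℝ≥0∞)⁻¹ ≤ edist (T m (z i).1 (z i).2 x) (T m w.1 w.2 x)}) atTop (𝓝 (ε + 0)) := by
    refine tendsto_const_nhds.add ?_
    rw [← Finset.sum_const_zero (s := Finset.range j)]
    exact tendsto_finsetSum _ fun m _ => (hbdd m).tendstoInMeasure hr0 hzw _
      (ENNReal.inv_pos.2 (ENNReal.natCast_ne_top j))
  rw [add_zero] at hlim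
  refine ge_of_tendsto' hlim fun i => ?_
  have hsub : U j ⊆ {x | a < maximalOperator T (z i).1 (z i).2 x} ∪
      ⋃ m ∈ Finset.range j, {x | (j : ℝ≥0∞)⁻¹ ≤ edist (T m (z i).1 (z i).2 x) (T m w.1 w.2 x)} := by
    intro x hx
    simp only [U, Set.mem_iUnion, Set.mem_ofPred_eq, exists_prop] at hx
    obtain ⟨m, hm, hx⟩ := hx
    by_contra hcon
    simp only [Set.mem_union, Set.mem_iUnion, Set.mem_ofPred_eq, not_or, not_exists, not_lt,
      not_le, exists_prop, not_and] at hcon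
    have h1 : ‖T m (z i).1 (z i).2 x‖ₑ ≤ a :=
      (le_iSup (fun m => ‖T m (z i).1 (z i).2 x‖ₑ) m).trans hcon.1
    have h2 := hcon.2 m hm
    refine absurd hx (not_lt.2 ?_)
    calc ‖T m w.1 w.2 x‖ₑ ≤ ‖T m (z i).1 (z i).2 x‖ₑ +
          edist (T m (z i).1 (z i).2 x) (T m w.1 w.2 x) := by
          rw [edist_comm, edist_eq_enorm_sub]
          simpa using enorm_add_le (T m (z i).1 (z i).2 x)
            (T m w.1 w.2 x - T m (z i).1 (z i).2 x)
      _ ≤ _ := add_le_add h1 h2.le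
  refine (measure_mono hsub).trans ((measure_union_le _ _).trans ?_)
  exact add_le_add (hz i) (measure_biUnion_finset_le _ _)

/-- A bilinear Banach principle. -/
theorem exists_measure_lt_maximalOperator_le [IsFiniteMeasure μ]
    (hbdd : ∀ m, IsBoundedBilinear (T m)) (hr0 : r ≠ 0)
    (hfin : ∀ f h, ∀ᵐ x ∂μ, maximalOperator T f h x < ⊤) {ε : ℝ≥0∞} (hε : ε ≠ 0) :
    ∃ L : ℝ, 0 < L ∧ ∀ f h, ‖f‖ ≤ 1 → ‖h‖ ≤ 1 →
      μ {x | ENNReal.ofReal L < maximalOperator T f h x} ≤ ε := by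
  let A : ℕ → Set (Lp 𝕜 p μ × Lp 𝕜 q μ) :=
    fun n => {z | μ {x | (n : ℝ≥0∞) < maximalOperator T z.1 z.2 x} ≤ ε / 4}
  have hε4 : 0 < ε / 4 := ENNReal.div_pos hε (by simp)
  have hcover : ⋃ n, A n = Set.univ := by
    refine Set.eq_univ_of_forall fun z => ?_
    have hzero : μ (⋂ n : ℕ, {x | (n : ℝ≥0∞) < maximalOperator T z.1 z.2 x}) = 0 := by
      refine measure_mono_null ?_ (ae_iff.1 (hfin z.1 z.2))
      intro x hx hlt
      obtain ⟨n, hn⟩ := ENNReal.exists_nat_gt hlt.ne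
      exact lt_asymm hn (Set.mem_iInter.1 hx n)
    have hlim := tendsto_measure_iInter_atTop (μ := μ)
      (s := fun n : ℕ => {x | (n : ℝ≥0∞) < maximalOperator T z.1 z.2 x})
      (fun n => (measurableSet_lt measurable_const
        (measurable_maximalOperator T z.1 z.2)).nullMeasurableSet)
      (fun i j hij x hx => lt_of_le_of_lt (Nat.cast_le.2 hij) (Set.mem_ofPred_eq ▸ hx)) ⟨0, measure_ne_top _ _⟩
    rw [hzero] at hlim
    obtain ⟨n, hn⟩ := (hlim.eventually_lt_const hε4).exists
    exact Set.mem_iUnion.2 ⟨n, hn.le⟩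
  obtain ⟨n, z, hz⟩ := nonempty_interior_of_iUnion_of_closed
    (f := A) (fun n => isClosed_setOf_measure_lt_maximalOperator_le T hbdd hr0 n (ε / 4)) hcover
  obtain ⟨ρ, hρ, hball⟩ := Metric.isOpen_iff.1 isOpen_interior z hz
  have hA : ∀ y ∈ Metric.ball z ρ, μ {x | (n : ℝ≥0∞) < maximalOperator T y.1 y.2 x} ≤ ε / 4 :=
    fun y hy => interior_subset (s := A n) (hball hy)
  set c : ℝ := ρ / 2 with hc
  have hc0 : 0 < c := by positivity
  -- `(c f, c h)` is a difference of points of the ball in each variable, so bilinearity costs a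
  -- factor 4 and scaling costs `c * c`; the `+ 1` keeps `L` positive when `n = 0`.
  refine ⟨4 * n / (c * c) + 1, by positivity, fun f h hf hh => ?_⟩
  have hcn : ‖(c : 𝕜)‖ = c := by simp [abs_of_pos hc0]
  have hce : ‖(c : 𝕜)‖ₑ = ENNReal.ofReal c := by rw [← ofReal_norm, hcn]
  have hnf : ‖(c : 𝕜) • f‖ < ρ := by
    rw [norm_smul, hcn]; nlinarith
  have hnh : ‖(c : 𝕜) • h‖ < ρ := by
    rw [norm_smul, hcn]; nlinarith
  have hmem : ∀ u v, ‖u‖ < ρ → ‖v‖ < ρ → (z.1 + u, z.2 + v) ∈ Metric.ball z ρ := by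
    intro u v hu hv
    rw [Metric.mem_ball, Prod.dist_eq, max_lt_iff]
    simpa using ⟨hu, hv⟩
  have h0p : ‖(0 : Lp 𝕜 p μ)‖ < ρ := by simpa using hρ
  have h0q : ‖(0 : Lp 𝕜 q μ)‖ < ρ := by simpa using hρ
  have b₁ := hA _ (hmem _ _ hnf hnh)
  have b₂ := hA _ (hmem _ _ hnf h0q)
  have b₃ := hA _ (hmem _ _ h0p hnh)
  have b₄ := hA _ (hmem _ _ h0p h0q)
  have hfour := ae_four_lt_maximalOperator T (z.1 + (c : 𝕜) • f) (z.1 + 0) (z.2 + (c : 𝕜) • h)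
    (z.2 + 0) n
  simp only [add_sub_add_left_eq_sub, sub_zero] at hfour
  have hle : {x | ENNReal.ofReal (4 * n / (c * c) + 1) < maximalOperator T f h x} ≤ᵐ[μ]
      (({x | (n : ℝ≥0∞) < maximalOperator T (z.1 + (c : 𝕜) • f) (z.2 + (c : 𝕜) • h) x} ∪
        {x | (n : ℝ≥0∞) < maximalOperator T (z.1 + (c : 𝕜) • f) (z.2 + 0) x}) ∪
        ({x | (n : ℝ≥0∞) < maximalOperator T (z.1 + 0) (z.2 + (c : 𝕜) • h) x} ∪
        {x | (n : ℝ≥0∞) < maximalOperator T (z.1 + 0) (z.2 + 0) x}) : Set M) := by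
    filter_upwards [hfour, maximalOperator_smul_smul T (c : 𝕜) (c : 𝕜) f h] with x hx hs hlt
    have hlt' : ENNReal.ofReal (4 * n / (c * c) + 1) < maximalOperator T f h x := hlt
    have : 4 * (n : ℝ≥0∞) < maximalOperator T ((c : 𝕜) • f) ((c : 𝕜) • h) x := by
      rw [hs, hce, ← ENNReal.ofReal_mul hc0.le]
      calc 4 * (n : ℝ≥0∞) = ENNReal.ofReal (4 * n) := by
            rw [ENNReal.ofReal_mul (by norm_num)]; simp
        _ ≤ ENNReal.ofReal (c * c) * ENNReal.ofReal (4 * n / (c * c) + 1) := by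
            rw [← ENNReal.ofReal_mul (by positivity)]
            refine ENNReal.ofReal_le_ofReal ?_
            rw [mul_add, mul_div_cancel₀ _ (by positivity)]
            nlinarith
        _ < _ := by
            refine ENNReal.mul_lt_mul_right ?_ ?_ hlt'
            · simpa using mul_pos hc0 hc0
            · exact ENNReal.ofReal_ne_top
    rcases hx this with h | h | h | h
    · exact Or.inl (Or.inl h)
    · exact Or.inl (Or.inr h)
    · exact Or.inr (Or.inl h)
    · exact Or.inr (Or.inr h)
  calc _ ≤ _ := measure_mono_ae hle
    _ ≤ (ε / 4 + ε / 4) + (ε / 4 + ε / 4) :=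
      (measure_union_le _ _).trans (add_le_add ((measure_union_le _ _).trans (add_le_add b₁ b₂))
        ((measure_union_le _ _).trans (add_le_add b₃ b₄)))
    _ = 4 * (ε / 4) := by ring
    _ = ε := ENNReal.mul_div_cancel (by simp) (by simp)

end MaximalOperator

/-! ### Random signs: type `p` and selection by averaging. -/

section RandomSigns

variable {ι : Type*} [Fintype ι] [DecidableEq ι]

/-- The signed sum `∑ j, ε j • f j`. -/
def signSum {V : Type*} [AddCommGroup V] (f : ι → V) (ε : ι → ℤˣ) : V :=
  ∑ j, ε j • f j

theorem signSum_mul_mulSingle_neg_one {V : Type*} [AddCommGroup V] (f : ι → V) (k : ι)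
    (ε : ι → ℤˣ) :
    signSum f (ε * Pi.mulSingle k (-1)) = signSum f ε - (2 * (ε k : ℤ)) • f k := by
  rw [signSum, signSum, eq_sub_iff_add_eq, ← Finset.add_sum_erase _ _ (Finset.mem_univ k),
    ← Finset.add_sum_erase _ _ (Finset.mem_univ k)]
  have : ∀ j ∈ Finset.univ.erase k, (ε * Pi.mulSingle k (-1) : ι → ℤˣ) j • f j = ε j • f j := by
    intro j hj
    simp [Pi.mulSingle_eq_of_ne (Finset.ne_of_mem_erase hj)]
  rw [Finset.sum_congr rfl this]
  simp only [Pi.mul_apply, Pi.mulSingle_eq_same, Units.smul_def, Units.val_neg,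
    Units.val_one, mul_smul, neg_smul, two_smul, smul_neg, one_smul]
  abel

/-- Spaces with a one-sided Clarkson inequality have type `p`. -/
theorem sum_signs_norm_sum_rpow_le {V : Type*} [NormedAddCommGroup V] {p : ℝ} (hp : p ≠ 0)
    (hV : ∀ a b : V, ‖a + b‖ ^ p + ‖a - b‖ ^ p ≤ 2 * (‖a‖ ^ p + ‖b‖ ^ p))
    (f : ι → V) (s : Finset ι) :
    ∑ ε : ι → ℤˣ, ‖∑ k ∈ s, ε k • f k‖ ^ p ≤
      Fintype.card (ι → ℤˣ) * ∑ k ∈ s, ‖f k‖ ^ p := by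
  induction s using Finset.induction_on with
  | empty => simp [Real.zero_rpow hp]
  | insert k s hk ih =>
    set A : (ι → ℤˣ) → V := fun ε => ∑ j ∈ s, ε j • f j with hA
    -- Flipping the sign at `k` permutes the sign vectors and leaves `A` unchanged.
    have hflip : ∑ ε : ι → ℤˣ, ‖ε k • f k + A ε‖ ^ p = ∑ ε : ι → ℤˣ, ‖-(ε k • f k) + A ε‖ ^ p := by
      refine Fintype.sum_equiv (Equiv.mulRight (Pi.mulSingle k (-1))) _ _ fun ε => ?_
      have : A (ε * Pi.mulSingle k (-1)) = A ε := by
        refine Finset.sum_congr rfl fun j hj => ?_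
        have hjk : j ≠ k := fun h => hk (h ▸ hj)
        simp [Pi.mulSingle_eq_of_ne hjk]
      simp [this, Units.smul_def]
    have hpt : ∀ ε : ι → ℤˣ, ‖ε k • f k + A ε‖ ^ p + ‖-(ε k • f k) + A ε‖ ^ p ≤
        2 * (‖A ε‖ ^ p + ‖f k‖ ^ p) := by
      intro ε
      have := hV (A ε) (ε k • f k)
      have hn : ‖ε k • f k‖ = ‖f k‖ := by
        rcases Int.units_eq_one_or (ε k) with h | h <;> simp [h, Units.smul_def]
      rw [hn] at this
      rwa [add_comm (ε k • f k), add_comm (-(ε k • f k)), ← sub_eq_add_neg]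
    have hsum := Finset.sum_le_sum fun ε (_ : ε ∈ (Finset.univ : Finset (ι → ℤˣ))) => hpt ε
    rw [Finset.sum_add_distrib, ← hflip, ← Finset.mul_sum, Finset.sum_add_distrib,
      Finset.sum_const, Finset.card_univ, nsmul_eq_mul] at hsum
    simp only [Finset.sum_insert hk]
    linarith

/-- The three averages are compared at once: the left side has mean at most `1/16 + 1/32 + 1/32 =
1/8`. One inequality thus gives both the lower bound on `u` and, when `u ≤ 1`, the bounds `a i ≤ 32
A`, `b j ≤ 32 B`. -/
theorem exists_le_of_average_le {Ω : Type*} [Fintype Ω] [Nonempty Ω] {u : Ω → Ω → ℝ} {a b : Ω → ℝ}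
    {A B : ℝ} (hA : 0 < A) (hB : 0 < B)
    (hu : (Fintype.card Ω : ℝ) * Fintype.card Ω / 8 ≤ ∑ i, ∑ j, u i j)
    (ha : ∑ i, a i ≤ Fintype.card Ω * A) (hb : ∑ i, b i ≤ Fintype.card Ω * B) :
    ∃ i j, 1 / 16 + a i / (32 * A) + b j / (32 * B) ≤ u i j := by
  by_contra! hcon
  have hK : (0 : ℝ) < Fintype.card Ω := by exact_mod_cast Fintype.card_pos
  have h1 : ∑ i, ∑ j, u i j < ∑ i : Ω, ∑ j : Ω, (1 / 16 + a i / (32 * A) + b j / (32 * B)) :=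
    Finset.sum_lt_sum_of_nonempty Finset.univ_nonempty fun i _ =>
      Finset.sum_lt_sum_of_nonempty Finset.univ_nonempty fun j _ => hcon i j
  have ha' : (∑ i, a i) / (32 * A) ≤ Fintype.card Ω / 32 := by
    rw [div_le_div_iff₀ (by positivity) (by positivity)]; nlinarith
  have hb' : (∑ i, b i) / (32 * B) ≤ Fintype.card Ω / 32 := by
    rw [div_le_div_iff₀ (by positivity) (by positivity)]; nlinarith
  simp only [Finset.sum_add_distrib, Finset.sum_const, Finset.card_univ, nsmul_eq_mul,
    ← Finset.sum_div, ← Finset.mul_sum] at h1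
  nlinarith

end RandomSigns

/-! ### One-sided Clarkson inequality for exponents at most 2. -/

section Clarkson

/-- Parallelogram law, then concavity and subadditivity of `t ↦ t ^ (p / 2)`. The `L^p` version
integrates the scalar case. -/
theorem norm_add_rpow_add_norm_sub_rpow_le (𝕜 : Type*) {V : Type*} [RCLike 𝕜]
    [NormedAddCommGroup V] [InnerProductSpace 𝕜 V] {p : ℝ} (hp0 : 0 ≤ p) (hp2 : p ≤ 2) (u v : V) :
    ‖u + v‖ ^ p + ‖u - v‖ ^ p ≤ 2 * (‖u‖ ^ p + ‖v‖ ^ p) := by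
  have hsq : ∀ w : V, ‖w‖ ^ p = (‖w‖ * ‖w‖) ^ (p / 2) := by
    intro w
    rw [← sq, ← Real.rpow_natCast, ← Real.rpow_mul (norm_nonneg _)]
    congr 1
    push_cast; ring
  have hpar := parallelogram_law_with_norm 𝕜 u v
  have hconc := (Real.concaveOn_rpow (p := p / 2) (by linarith) (by linarith)).2
    (Set.mem_Ici.2 (mul_self_nonneg ‖u + v‖)) (Set.mem_Ici.2 (mul_self_nonneg ‖u - v‖))
    (by norm_num : (0 : ℝ) ≤ 1 / 2) (by norm_num : (0 : ℝ) ≤ 1 / 2) (by norm_num)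
  have hmid : (1 / 2 : ℝ) • (‖u + v‖ * ‖u + v‖) + (1 / 2 : ℝ) • (‖u - v‖ * ‖u - v‖) =
      ‖u‖ * ‖u‖ + ‖v‖ * ‖v‖ := by
    simp only [smul_eq_mul]; linarith
  rw [hmid] at hconc
  simp only [smul_eq_mul] at hconc
  have hsub := Real.rpow_add_le_add_rpow (mul_self_nonneg ‖u‖) (mul_self_nonneg ‖v‖)
    (by linarith : 0 ≤ p / 2) (by linarith)
  rw [hsq (u + v), hsq (u - v), hsq u, hsq v]
  linarith

variable {𝕜 M : Type*} [RCLike 𝕜] [MeasurableSpace M] {μ : Measure M} {p : ℝ≥0∞}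

theorem ofReal_norm_rpow_eq_lintegral (hp0 : p ≠ 0) (hpt : p ≠ ⊤) (a : Lp 𝕜 p μ) :
    ENNReal.ofReal (‖a‖ ^ p.toReal) = ∫⁻ x, ‖a x‖ₑ ^ p.toReal ∂μ := by
  have hpos := ENNReal.toReal_pos hp0 hpt
  rw [Lp.norm_def, ← ENNReal.ofReal_rpow_of_nonneg ENNReal.toReal_nonneg hpos.le,
    ENNReal.ofReal_toReal (Lp.eLpNorm_ne_top a), eLpNorm_eq_lintegral_rpow_enorm_toReal hp0 hpt,
    one_div, ENNReal.rpow_inv_rpow hpos.ne']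

theorem MeasureTheory.Lp.norm_add_rpow_add_norm_sub_rpow_le (hp0 : p ≠ 0) (hp2 : p ≤ 2) (a b : Lp 𝕜 p μ) :
    ‖a + b‖ ^ p.toReal + ‖a - b‖ ^ p.toReal ≤ 2 * (‖a‖ ^ p.toReal + ‖b‖ ^ p.toReal) := by
  have hpt : p ≠ ⊤ := (hp2.trans_lt (by simp)).ne
  have hn : ∀ c : Lp 𝕜 p μ, 0 ≤ ‖c‖ ^ p.toReal := fun c =>
    Real.rpow_nonneg ENNReal.toReal_nonneg _
  have hm : ∀ c : Lp 𝕜 p μ, Measurable fun x => ‖c x‖ₑ ^ p.toReal := fun c =>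
    (Lp.stronglyMeasurable c).enorm.pow_const _
  have he : ∀ w : 𝕜, ‖w‖ₑ ^ p.toReal = ENNReal.ofReal (‖w‖ ^ p.toReal) := fun w => by
    rw [← ofReal_norm, ENNReal.ofReal_rpow_of_nonneg (norm_nonneg _) ENNReal.toReal_nonneg]
  have h2 : p.toReal ≤ 2 := by simpa using ENNReal.toReal_mono (by simp) hp2
  rw [← ENNReal.ofReal_le_ofReal_iff (mul_nonneg zero_le_two (add_nonneg (hn a) (hn b))),
    ENNReal.ofReal_add (hn _) (hn _), ENNReal.ofReal_mul zero_le_two,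
    ENNReal.ofReal_add (hn _) (hn _)]
  simp only [ofReal_norm_rpow_eq_lintegral hp0 hpt]
  rw [← lintegral_add_left (hm _), ← lintegral_add_left (hm _),
    ← lintegral_const_mul (ENNReal.ofReal 2) (f := fun x => ‖a x‖ₑ ^ p.toReal + ‖b x‖ₑ ^ p.toReal)
      ((hm a).add (hm b))]
  refine lintegral_mono_ae ?_
  filter_upwards [Lp.coeFn_add a b, Lp.coeFn_sub a b] with x h₁ h₃
  rw [h₁, h₃, Pi.add_apply, Pi.sub_apply]
  have hnn : ∀ w : 𝕜, 0 ≤ ‖w‖ ^ p.toReal := fun w => by positivity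
  rw [he, he, he, he, ← ENNReal.ofReal_add (hnn _) (hnn _), ← ENNReal.ofReal_add (hnn _) (hnn _),
    ← ENNReal.ofReal_mul zero_le_two]
  exact ENNReal.ofReal_le_ofReal
    (_root_.norm_add_rpow_add_norm_sub_rpow_le 𝕜 ENNReal.toReal_nonneg h2 _ _)

end Clarkson

/-! ### The maximal operator on signed sums. -/

section RandomizedMaximal

variable {ι : Type*} [Fintype ι] [DecidableEq ι]
  {𝕜 M : Type*} [RCLike 𝕜] [MeasurableSpace M] {μ : Measure M} {p q r : ℝ≥0∞}
  (T : ℕ → Lp 𝕜 p μ →ₗ[𝕜] Lp 𝕜 q μ →ₗ[𝕜] Lp 𝕜 r μ)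

theorem enorm_two_mul_intUnit (e : ℤˣ) : ‖((2 * (e : ℤ) : ℤ) : 𝕜)‖ₑ = 2 := by
  rcases Int.units_eq_one_or e with h | h
  all_goals
    rw [← ofReal_norm, h]
    simp

theorem ae_lt_maximalOperator_signs (f : ι → Lp 𝕜 p μ) (h : ι → Lp 𝕜 q μ) (a : ℝ≥0∞)
    (ε δ : ι → ℤˣ) (k : ι) :
    ∀ᵐ x ∂μ, a < maximalOperator T (f k) (h k) x →
      a < maximalOperator T (signSum f ε) (signSum h δ) x ∨
      a < maximalOperator T (signSum f ε) (signSum h (δ * Pi.mulSingle k (-1))) x ∨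
      a < maximalOperator T (signSum f (ε * Pi.mulSingle k (-1))) (signSum h δ) x ∨
      a < maximalOperator T (signSum f (ε * Pi.mulSingle k (-1)))
        (signSum h (δ * Pi.mulSingle k (-1))) x := by
  have h4 := ae_four_lt_maximalOperator T (signSum f ε)
    (signSum f (ε * Pi.mulSingle k (-1))) (signSum h δ)
    (signSum h (δ * Pi.mulSingle k (-1))) a
  have e₁ : signSum f ε - signSum f (ε * Pi.mulSingle k (-1)) =
      ((2 * (ε k : ℤ) : ℤ) : 𝕜) • f k := by
    rw [signSum_mul_mulSingle_neg_one, Int.cast_smul_eq_zsmul, sub_sub_cancel]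
  have e₂ : signSum h δ - signSum h (δ * Pi.mulSingle k (-1)) =
      ((2 * (δ k : ℤ) : ℤ) : 𝕜) • h k := by
    rw [signSum_mul_mulSingle_neg_one, Int.cast_smul_eq_zsmul, sub_sub_cancel]
  rw [e₁, e₂] at h4
  filter_upwards [h4, maximalOperator_smul_smul T ((2 * (ε k : ℤ) : ℤ) : 𝕜)
    ((2 * (δ k : ℤ) : ℤ) : 𝕜) (f k) (h k)] with x hx hs ha
  apply hx
  rw [hs, enorm_two_mul_intUnit, enorm_two_mul_intUnit]
  norm_num
  exact ENNReal.mul_lt_mul_right (by simp) (by simp) ha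

theorem card_mul_card_mul_measure_iUnion_le (f : ι → Lp 𝕜 p μ) (h : ι → Lp 𝕜 q μ) (a : ℝ≥0∞) :
    (Fintype.card (ι → ℤˣ) : ℝ≥0∞) * Fintype.card (ι → ℤˣ) *
        μ (⋃ k, {x | a < maximalOperator T (f k) (h k) x}) ≤
      4 * ∑ ε : ι → ℤˣ, ∑ δ : ι → ℤˣ,
        μ {x | a < maximalOperator T (signSum f ε) (signSum h δ) x} := by
  set S : (ι → ℤˣ) → (ι → ℤˣ) → Set M := fun ε δ =>
    {x | a < maximalOperator T (signSum f ε) (signSum h δ) x} with hS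
  have hSm : ∀ ε δ, MeasurableSet (S ε δ) := fun ε δ =>
    measurableSet_lt measurable_const (measurable_maximalOperator T _ _)
  have hUm : MeasurableSet (⋃ k, {x | a < maximalOperator T (f k) (h k) x}) :=
    MeasurableSet.iUnion fun k =>
      measurableSet_lt measurable_const (measurable_maximalOperator T _ _)
  have hpt : ∀ᵐ x ∂μ, (Fintype.card (ι → ℤˣ) : ℝ≥0∞) * Fintype.card (ι → ℤˣ) *
      (⋃ k, {x | a < maximalOperator T (f k) (h k) x}).indicator 1 x ≤
      4 * ∑ ε, ∑ δ, (S ε δ).indicator 1 x := by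
    filter_upwards [ae_all_iff.2 fun ε => ae_all_iff.2 fun δ => ae_all_iff.2 fun k =>
      ae_lt_maximalOperator_signs T f h a ε δ k] with x hx
    by_cases hxU : x ∈ ⋃ k, {x | a < maximalOperator T (f k) (h k) x}
    · obtain ⟨k, hk⟩ := Set.mem_iUnion.1 hxU
      set χ : (ι → ℤˣ) → (ι → ℤˣ) → ℝ≥0∞ := fun ε δ => (S ε δ).indicator 1 x with hχ
      let σ : (ι → ℤˣ) ≃ (ι → ℤˣ) := Equiv.mulRight (Pi.mulSingle k (-1))
      have hχ1 : ∀ ε δ, x ∈ S ε δ → χ ε δ = 1 := fun ε δ hh => by simp [hχ, hh]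
      -- Each of the four terms has the same total over all sign pairs, since `σ` is a bijection;
      -- this yields the factor 4.
      have hone : ∀ ε δ, 1 ≤ χ ε δ + χ ε (σ δ) + χ (σ ε) δ + χ (σ ε) (σ δ) := by
        intro ε δ
        rcases hx ε δ k hk with hh | hh | hh | hh
        · rw [hχ1 ε δ hh]
          exact le_add_right (le_add_right le_self_add)
        · rw [hχ1 ε (σ δ) hh]
          exact le_add_right (le_add_right le_add_self)
        · rw [hχ1 (σ ε) δ hh]
          exact le_add_right le_add_self
        · rw [hχ1 (σ ε) (σ δ) hh]
          exact le_add_self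
      have r₁ : ∑ ε, ∑ δ, χ ε (σ δ) = ∑ ε, ∑ δ, χ ε δ :=
        Finset.sum_congr rfl fun ε _ => Equiv.sum_comp σ _
      have r₂ : ∑ ε, ∑ δ, χ (σ ε) δ = ∑ ε, ∑ δ, χ ε δ :=
        Equiv.sum_comp σ fun ε => ∑ δ, χ ε δ
      have r₃ : ∑ ε, ∑ δ, χ (σ ε) (σ δ) = ∑ ε, ∑ δ, χ ε δ :=
        (Equiv.sum_comp σ fun ε => ∑ δ, χ ε (σ δ)).trans r₁
      calc _ = ∑ ε : ι → ℤˣ, ∑ δ : ι → ℤˣ, (1 : ℝ≥0∞) := by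
            rw [Set.indicator_of_mem hxU]
            simp only [Finset.sum_const, Finset.card_univ, nsmul_eq_mul, Pi.one_apply, mul_one]
        _ ≤ ∑ ε, ∑ δ, (χ ε δ + χ ε (σ δ) + χ (σ ε) δ + χ (σ ε) (σ δ)) :=
            Finset.sum_le_sum fun ε _ => Finset.sum_le_sum fun δ _ => hone ε δ
        _ = 4 * ∑ ε, ∑ δ, χ ε δ := by
            simp only [Finset.sum_add_distrib, r₁, r₂, r₃]
            ring
    · simp [Set.indicator_of_notMem hxU]
  have hint := lintegral_mono_ae hpt
  rw [lintegral_const_mul _ (measurable_one.indicator hUm), lintegral_indicator_one hUm,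
    lintegral_const_mul _ (Finset.measurable_sum _ fun ε _ => Finset.measurable_sum _ fun δ _ =>
      measurable_one.indicator (hSm ε δ)),
    lintegral_finsetSum _ fun ε _ => Finset.measurable_sum _ fun δ _ =>
      measurable_one.indicator (hSm ε δ)] at hint
  refine hint.trans_eq ?_
  congr 1
  refine Finset.sum_congr rfl fun ε _ => ?_
  rw [lintegral_finsetSum _ fun δ _ => measurable_one.indicator (hSm ε δ)]
  exact Finset.sum_congr rfl fun δ _ => lintegral_indicator_one (hSm ε δ)

end RandomizedMaximal

/-! ### Translates of functions and their signed sums. -/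

section Translates

variable {𝕜 G M : Type*} [RCLike 𝕜] [Group G] [MulAction G M] [MeasurableSpace M]
  [MeasurableConstSMul G M] {μ : Measure M} [SMulInvariantMeasure G M μ] {p q r : ℝ≥0∞}

theorem norm_lpTranslate (g : G) (f : Lp 𝕜 p μ) : ‖lpTranslate g f‖ = ‖f‖ :=
  Lp.norm_compMeasurePreserving f (measurePreserving_smul g⁻¹ μ)

theorem maximalOperator_lpTranslate {T : ℕ → Lp 𝕜 p μ →ₗ[𝕜] Lp 𝕜 q μ →ₗ[𝕜] Lp 𝕜 r μ}
    (hcomm : ∀ m, CommutesWithTranslations G (T m)) (g : G) (f : Lp 𝕜 p μ) (h : Lp 𝕜 q μ) :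
    ∀ᵐ x ∂μ, maximalOperator T (lpTranslate g f) (lpTranslate g h) x =
      maximalOperator T f h (g⁻¹ • x) := by
  have key : ∀ m, ∀ᵐ x ∂μ, T m (lpTranslate g f) (lpTranslate g h) x = T m f h (g⁻¹ • x) := by
    intro m
    rw [hcomm m g f h]
    exact Lp.coeFn_compMeasurePreserving _ (measurePreserving_smul g⁻¹ μ)
  filter_upwards [ae_all_iff.2 key] with x hx
  simp only [maximalOperator, hx]

theorem sum_norm_signSum_lpTranslate_rpow_le [Fact (1 ≤ p)] (hp2 : p ≤ 2) {N : ℕ} (g : Fin N → G)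
    (f : Lp 𝕜 p μ) :
    ∑ ε : Fin N → ℤˣ, ‖signSum (fun k => lpTranslate (g k) f) ε‖ ^ p.toReal ≤
      Fintype.card (Fin N → ℤˣ) * (N * ‖f‖ ^ p.toReal) := by
  have h1 : (1 : ℝ≥0∞) ≤ p := Fact.out
  have hp0 : p ≠ 0 := (zero_lt_one.trans_le h1).ne'
  have hpt : p ≠ ⊤ := (hp2.trans_lt (by simp)).ne
  have := sum_signs_norm_sum_rpow_le (ENNReal.toReal_pos hp0 hpt).ne'
    (Lp.norm_add_rpow_add_norm_sub_rpow_le hp0 hp2) (fun k => lpTranslate (g k) f) Finset.univ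
  simpa [signSum, norm_lpTranslate] using this

end Translates

/-! ### Rescaling, and the choice of a good signed sum. -/

section Scaling

variable {𝕜 M : Type*} [RCLike 𝕜] [MeasurableSpace M] {μ : Measure M} {p q r : ℝ≥0∞}
  {T : ℕ → Lp 𝕜 p μ →ₗ[𝕜] Lp 𝕜 q μ →ₗ[𝕜] Lp 𝕜 r μ} [Fact (1 ≤ p)] [Fact (1 ≤ q)]

/-- Rescaling of an estimate on the unit balls. -/
theorem measure_lt_maximalOperator_le_of_norm_le {L : ℝ} {ε : ℝ≥0∞}
    (hL : ∀ f h, ‖f‖ ≤ 1 → ‖h‖ ≤ 1 → μ {x | ENNReal.ofReal L < maximalOperator T f h x} ≤ ε)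
    {f : Lp 𝕜 p μ} {h : Lp 𝕜 q μ} {a b α : ℝ} (ha : 0 < a) (hb : 0 < b) (hf : ‖f‖ ≤ a)
    (hh : ‖h‖ ≤ b) (hα : L * (a * b) ≤ α) :
    μ {x | ENNReal.ofReal α < maximalOperator T f h x} ≤ ε := by
  have hn : ∀ {c : ℝ}, 0 < c → ‖((c⁻¹ : ℝ) : 𝕜)‖ = c⁻¹ := fun hc => by
    simp [abs_of_pos hc]
  have hne : ∀ {c : ℝ}, 0 < c → ‖((c⁻¹ : ℝ) : 𝕜)‖ₑ = ENNReal.ofReal c⁻¹ := fun hc => by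
    rw [← ofReal_norm, hn hc]
  refine le_trans (measure_mono_ae ?_) (hL (((a⁻¹ : ℝ) : 𝕜) • f) (((b⁻¹ : ℝ) : 𝕜) • h) ?_ ?_)
  · filter_upwards [maximalOperator_smul_smul T ((a⁻¹ : ℝ) : 𝕜) ((b⁻¹ : ℝ) : 𝕜) f h] with x hx hlt
    have hlt' : ENNReal.ofReal α < maximalOperator T f h x := hlt
    change ENNReal.ofReal L < maximalOperator T _ _ x
    rw [hx, hne ha, hne hb, ← ENNReal.ofReal_mul (by positivity)]
    calc ENNReal.ofReal L ≤ ENNReal.ofReal (a⁻¹ * b⁻¹) * ENNReal.ofReal α := by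
          rw [← ENNReal.ofReal_mul (by positivity)]
          refine ENNReal.ofReal_le_ofReal ?_
          rw [← mul_inv, inv_mul_eq_div, le_div_iff₀ (by positivity)]
          exact hα
      _ < _ := ENNReal.mul_lt_mul_right 
          (ENNReal.ofReal_pos.2 (by positivity)).ne' ENNReal.ofReal_ne_top hlt'
  · rw [norm_smul, hn ha, inv_mul_eq_div]
    exact div_le_one_of_le₀ hf ha.le
  · rw [norm_smul, hn hb, inv_mul_eq_div]
    exact div_le_one_of_le₀ hh hb.le

end Scaling

section RandomTranslates

variable {𝕜 G M : Type*} [RCLike 𝕜]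
  [Group G] [TopologicalSpace G] [IsTopologicalGroup G] [CompactSpace G]
  [TopologicalSpace M] [MulAction G M] [ContinuousSMul G M] [MulAction.IsPretransitive G M]
  [MeasurableSpace M] [BorelSpace M]
  {μ : Measure M} [μ.Regular] [IsProbabilityMeasure μ] [SMulInvariantMeasure G M μ]
  {p q r : ℝ≥0∞} [Fact (1 ≤ p)] [Fact (1 ≤ q)]

/-- If `T*(f, h) > α` on a set `E` of positive measure, then signed sums of about `1 / μ E`
translates of `f` and `h` give a function pair of controlled norm for which `T* > α` holds on a
set of measure bounded below. -/
theorem exists_norm_le_of_lt_maximalOperator (hp2 : p ≤ 2) (hq2 : q ≤ 2)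
    {T : ℕ → Lp 𝕜 p μ →ₗ[𝕜] Lp 𝕜 q μ →ₗ[𝕜] Lp 𝕜 r μ}
    (hcomm : ∀ m, CommutesWithTranslations G (T m)) {f : Lp 𝕜 p μ} {h : Lp 𝕜 q μ}
    (hf : 0 < ‖f‖) (hh : 0 < ‖h‖) {α : ℝ≥0∞}
    (hpos : 0 < μ.real {x | α < maximalOperator T f h x}) :
    ∃ (N : ℕ) (F : Lp 𝕜 p μ) (H : Lp 𝕜 q μ), 0 < N ∧
      N * μ.real {x | α < maximalOperator T f h x} ≤ 3 ∧
      ‖F‖ ^ p.toReal ≤ 32 * N * ‖f‖ ^ p.toReal ∧ ‖H‖ ^ q.toReal ≤ 32 * N * ‖h‖ ^ q.toReal ∧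
      1 / 16 ≤ μ.real {x | α < maximalOperator T F H x} := by
  have hEm : ∀ (F : Lp 𝕜 p μ) (H : Lp 𝕜 q μ), MeasurableSet {x | α < maximalOperator T F H x} :=
    fun F H => measurableSet_lt measurable_const (measurable_maximalOperator T F H)
  obtain ⟨N, g, hN, hNE, hU⟩ := exists_half_le_measureReal_iUnion_smul G μ (hEm f h) hpos
  have hN' : (0 : ℝ) < N := by exact_mod_cast hN
  set fk : Fin N → Lp 𝕜 p μ := fun k => lpTranslate (g k) f with hfk
  set hk : Fin N → Lp 𝕜 q μ := fun k => lpTranslate (g k) h with hhk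
  have hUae : (⋃ k, {x | α < maximalOperator T (fk k) (hk k) x} : Set M) =ᵐ[μ]
      (⋃ k, (fun x : M => (g k)⁻¹ • x) ⁻¹' {x | α < maximalOperator T f h x} : Set M) := by
    refine Filter.EventuallyEq.countable_iUnion fun k => ?_
    filter_upwards [maximalOperator_lpTranslate hcomm (g k) f h] with x hx
    exact congrArg (α < ·) hx
  have hcard := card_mul_card_mul_measure_iUnion_le T fk hk α
  rw [measure_congr hUae] at hcard
  have hcardR := ENNReal.toReal_mono (by
    refine ENNReal.mul_ne_top (by simp) (ENNReal.sum_ne_top.2 fun _ _ =>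
      ENNReal.sum_ne_top.2 fun _ _ => measure_ne_top _ _)) hcard
  rw [ENNReal.toReal_mul, ENNReal.toReal_mul, ENNReal.toReal_mul,
    ENNReal.toReal_sum (fun _ _ => ENNReal.sum_ne_top.2 fun _ _ => measure_ne_top _ _)] at hcardR
  simp only [ENNReal.toReal_sum (fun _ _ => measure_ne_top μ _), ENNReal.toReal_natCast,
    ENNReal.toReal_ofNat, ← measureReal_def] at hcardR
  have hK : (0 : ℝ) < Fintype.card (Fin N → ℤˣ) := by exact_mod_cast Fintype.card_pos
  have hfp : 0 < (N : ℝ) * ‖f‖ ^ p.toReal := mul_pos hN' (Real.rpow_pos_of_pos hf _)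
  have hhq : 0 < (N : ℝ) * ‖h‖ ^ q.toReal := mul_pos hN' (Real.rpow_pos_of_pos hh _)
  obtain ⟨ε, δ, hεδ⟩ := exists_le_of_average_le
    (u := fun ε δ => μ.real {x | α < maximalOperator T (signSum fk ε) (signSum hk δ) x})
    -- Half the space is covered and a quarter of the sign pairs work there, hence the average 1/8.
    hfp hhq (by
      have := mul_le_mul_of_nonneg_left hU (mul_pos hK hK).le
      linarith)
    (sum_norm_signSum_lpTranslate_rpow_le hp2 g f) (sum_norm_signSum_lpTranslate_rpow_le hq2 g h)
  have hle1 : μ.real {x | α < maximalOperator T (signSum fk ε) (signSum hk δ) x} ≤ 1 :=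
    measureReal_le_one
  have hFn : 0 ≤ ‖signSum fk ε‖ ^ p.toReal / (32 * (N * ‖f‖ ^ p.toReal)) := by positivity
  have hHn : 0 ≤ ‖signSum hk δ‖ ^ q.toReal / (32 * (N * ‖h‖ ^ q.toReal)) := by positivity
  refine ⟨N, signSum fk ε, signSum hk δ, hN, hNE, ?_, ?_, by linarith⟩
  · have : ‖signSum fk ε‖ ^ p.toReal / (32 * (N * ‖f‖ ^ p.toReal)) ≤ 1 := by linarith
    rwa [div_le_one (by positivity), ← mul_assoc] at this
  · have : ‖signSum hk δ‖ ^ q.toReal / (32 * (N * ‖h‖ ^ q.toReal)) ≤ 1 := by linarith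
    rwa [div_le_one (by positivity), ← mul_assoc] at this

end RandomTranslates

/-! ### The weak type estimate. -/

theorem le_rpow_inv_mul_of_rpow_le {a b c s : ℝ} (ha : 0 ≤ a) (hb : 0 ≤ b) (hc : 0 ≤ c)
    (hs : 0 < s) (h : a ^ s ≤ c * b ^ s) : a ≤ c ^ s⁻¹ * b := by
  rw [← Real.rpow_le_rpow_iff ha (by positivity) hs, Real.mul_rpow (by positivity) hb,
    Real.rpow_inv_rpow hc hs.ne']
  exact h

theorem maximalOperator_eq_zero_of_norm_eq_zero {𝕜 M : Type*} [RCLike 𝕜] [MeasurableSpace M]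
    {μ : Measure M} {p q r : ℝ≥0∞} [Fact (1 ≤ p)] [Fact (1 ≤ q)]
    (T : ℕ → Lp 𝕜 p μ →ₗ[𝕜] Lp 𝕜 q μ →ₗ[𝕜] Lp 𝕜 r μ) {f : Lp 𝕜 p μ} {h : Lp 𝕜 q μ}
    (h0 : ‖f‖ = 0 ∨ ‖h‖ = 0) : ∀ᵐ x ∂μ, maximalOperator T f h x = 0 := by
  rcases h0 with h0 | h0
  · rw [norm_eq_zero.1 h0]
    simpa using maximalOperator_smul_smul T 0 1 0 h
  · rw [norm_eq_zero.1 h0]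
    simpa using maximalOperator_smul_smul T 1 0 f 0

theorem theorem1 {𝕜 G M : Type*} [RCLike 𝕜]
    [Group G] [TopologicalSpace G] [IsTopologicalGroup G] [CompactSpace G]
    [TopologicalSpace M] [MulAction G M] [ContinuousSMul G M] [MulAction.IsPretransitive G M]
    [MeasurableSpace M] [BorelSpace M]
    (μ : Measure M) [μ.Regular] [IsProbabilityMeasure μ] [SMulInvariantMeasure G M μ]
    (p q r : ℝ≥0∞) (hp : 1 ≤ p) (hp2 : p ≤ 2) (hq : 1 ≤ q) (hq2 : q ≤ 2)
    (hr : r⁻¹ = p⁻¹ + q⁻¹)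
    (T : ℕ → Lp 𝕜 p μ →ₗ[𝕜] Lp 𝕜 q μ →ₗ[𝕜] Lp 𝕜 r μ)
    (hbdd : ∀ m, IsBoundedBilinear (T m))
    (hcomm : ∀ m, CommutesWithTranslations G (T m))
    (hconv : ∀ (f : Lp 𝕜 p μ) (h : Lp 𝕜 q μ),
      ∀ᵐ x ∂μ, ∃ l : 𝕜, Tendsto (fun m => T m f h x) atTop (𝓝 l)) :
    ∃ C : ℝ, 0 < C ∧ ∀ (f : Lp 𝕜 p μ) (h : Lp 𝕜 q μ) (α : ℝ), 0 < α →
      μ {x | ENNReal.ofReal α < maximalOperator T f h x} ≤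
        ENNReal.ofReal (C / α ^ r.toReal * ‖f‖ ^ r.toReal * ‖h‖ ^ r.toReal) := by
  have : Fact (1 ≤ p) := ⟨hp⟩
  have : Fact (1 ≤ q) := ⟨hq⟩
  have hp0 : p ≠ 0 := (zero_lt_one.trans_le hp).ne'
  have hq0 : q ≠ 0 := (zero_lt_one.trans_le hq).ne'
  have hpt : p ≠ ⊤ := (hp2.trans_lt (by simp)).ne
  have hqt : q ≠ ⊤ := (hq2.trans_lt (by simp)).ne
  have hrt : r ≠ ⊤ := by
    rintro rfl
    have hp' := (add_eq_zero.1 (hr.symm.trans ENNReal.inv_top)).1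
    exact hpt (ENNReal.inv_eq_zero.1 hp')
  have hr0 : r ≠ 0 := by
    rintro rfl
    rcases ENNReal.add_eq_top.1 (hr.symm.trans ENNReal.inv_zero) with h | h
    · exact hp0 (ENNReal.inv_eq_top.1 h)
    · exact hq0 (ENNReal.inv_eq_top.1 h)
  have hrR : r.toReal⁻¹ = p.toReal⁻¹ + q.toReal⁻¹ := by
    rw [← ENNReal.toReal_inv, hr, ENNReal.toReal_add (by simpa) (by simpa), ENNReal.toReal_inv,
      ENNReal.toReal_inv]
  have hppos := ENNReal.toReal_pos hp0 hpt
  have hqpos := ENNReal.toReal_pos hq0 hqt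
  have hrpos := ENNReal.toReal_pos hr0 hrt
  obtain ⟨L, hL0, hL⟩ := exists_measure_lt_maximalOperator_le T hbdd hr0
    (fun f h => maximalOperator_lt_top_of_convergent T f h (hconv f h))
    -- Any level below the 1/16 of `exists_norm_le_of_lt_maximalOperator` would do.
    (ε := ENNReal.ofReal (1 / 32)) (by simp)
  -- `96 = 32 * 3`: 32 from the norm bounds on `F` and `H`, 3 from `N * d ≤ 3`.
  refine ⟨96 * L ^ r.toReal, by positivity, fun f h α hα => ?_⟩
  rcases (norm_nonneg f).eq_or_lt with hf | hf
  · refine (measure_mono_null (fun x hx => ?_) (ae_iff.1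
      (maximalOperator_eq_zero_of_norm_eq_zero T (h := h) (Or.inl hf.symm)))).trans_le zero_le
    exact (lt_of_le_of_lt zero_le hx).ne'
  rcases (norm_nonneg h).eq_or_lt with hh | hh
  · refine (measure_mono_null (fun x hx => ?_) (ae_iff.1
      (maximalOperator_eq_zero_of_norm_eq_zero T (f := f) (Or.inr hh.symm)))).trans_le zero_le
    exact (lt_of_le_of_lt zero_le hx).ne'
  rw [← ofReal_measureReal]
  refine ENNReal.ofReal_le_ofReal ?_
  rcases (measureReal_nonneg (μ := μ)
    (s := {x | ENNReal.ofReal α < maximalOperator T f h x})).eq_or_lt with hE | hE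
  · rw [← hE]
    positivity
  obtain ⟨N, F, H, hN, hNE, hF, hH, hFH⟩ :=
    exists_norm_le_of_lt_maximalOperator hp2 hq2 hcomm hf hh hE
  have hN' : (0 : ℝ) < N := by exact_mod_cast hN
  set d := μ.real {x | ENNReal.ofReal α < maximalOperator T f h x}
  have hF' := le_rpow_inv_mul_of_rpow_le (norm_nonneg F) hf.le (by positivity) hppos hF
  have hH' := le_rpow_inv_mul_of_rpow_le (norm_nonneg H) hh.le (by positivity) hqpos hH
  have hαL : α ≤ L * ((32 * N : ℝ) ^ r.toReal⁻¹ * ‖f‖ * ‖h‖) := by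
    by_contra! hlt
    have hprod : (32 * N : ℝ) ^ p.toReal⁻¹ * ‖f‖ * ((32 * N : ℝ) ^ q.toReal⁻¹ * ‖h‖) =
        (32 * N : ℝ) ^ r.toReal⁻¹ * ‖f‖ * ‖h‖ := by
      rw [hrR, Real.rpow_add (by positivity)]
      ring
    have := measure_lt_maximalOperator_le_of_norm_le hL (by positivity) (by positivity) hF' hH'
      (α := α) (by rw [hprod]; exact hlt.le)
    have h2 := ENNReal.toReal_mono ENNReal.ofReal_ne_top this
    rw [ENNReal.toReal_ofReal (by norm_num), ← measureReal_def] at h2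
    linarith
  have hpow := Real.rpow_le_rpow hα.le hαL hrpos.le
  rw [Real.mul_rpow hL0.le (by positivity), Real.mul_rpow (by positivity) hh.le,
    Real.mul_rpow (by positivity) hf.le, Real.rpow_inv_rpow (by positivity) hrpos.ne'] at hpow
  rw [div_mul_eq_mul_div, div_mul_eq_mul_div, le_div_iff₀ (by positivity)]
  have hfr : 0 ≤ L ^ r.toReal * ‖f‖ ^ r.toReal * ‖h‖ ^ r.toReal := by positivity
  calc d * α ^ r.toReal
      ≤ d * (L ^ r.toReal * (32 * N * ‖f‖ ^ r.toReal * ‖h‖ ^ r.toReal)) := by gcongr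
    _ = 32 * (L ^ r.toReal * ‖f‖ ^ r.toReal * ‖h‖ ^ r.toReal) * (N * d) := by ring
    _ ≤ 32 * (L ^ r.toReal * ‖f‖ ^ r.toReal * ‖h‖ ^ r.toReal) * 3 := by gcongr
    _ = 96 * L ^ r.toReal * ‖f‖ ^ r.toReal * ‖h‖ ^ r.toReal := by ring
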